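/- **Setting.** Let $\mathcal X\subset\mathbb R$ be a nontrivial interval (an interval of positive length), $n\ge 1$, and let $x_1\le\dots\le x_n$ be design points in $\mathcal X$, with $\mathbf x=(x_1,\dots,x_n)$. Let $Y_1,\dots,Y_n$ be independent integrable real random variables with $\mathbb E[Y_i]=f^\star(x_i)$ for a function $f^\star:\mathcal X\to\mathbb R$, and for $p\in[1,2]$ let $\sigma_p\in[0,+\infty]$ be any number such that $\big(\frac1n\sum_{i=1}^n\mathbb E[|Y_i-\mathbb E[Y_i]|^p]\big)^{1/p}\le\sigma_p$. For functions $f,g$ on $\mathcal X$ put $\ell(f,g)=\frac1n\sum_{i=1}^n|f(x_i)-g(x_i)|$, and $\ell(f,\mathcal G)=\inf_{g\in\mathcal G}\ell(f,g)$ for a class $\mathcal G$ of functions (equal to $+\infty$ if $\mathcal G=\varnothing$). Given a class $\mathcal F$ of functions on $\mathcal X$ and an integer $D\ge1$, let $\mathcal O(D)$ be the set of those $\bar f\in\mathcal F$ for which the two classes of subsets $\{x\in\mathcal X_n: f(x)>\bar f(x)\}$, $f\in\mathcal F$, and $\{x\in\mathcal X_n: f(x)<\bar f(x)\}$, $f\in\mathcal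 F$, of the set $\mathcal X_n=\{x_1,\dots,x_n\}$ both have VC-dimension at most $D$. For a constant $\kappa>0$, the risk bound on $\mathcal F$ is $$B_n(f^\star,\mathcal F)=\inf_{D\ge1}\Big\{3\,\ell\big(f^\star,\mathcal O(D)\big)+\kappa\inf_{q\in[1,2]}\Big[\sigma_q\Big(\frac Dn\Big)^{1-\frac1q}\Big]\Big\}.$$ For $k\ge1$ let $\mathcal M_k$ be the class of functions on $\mathcal X$ that are monotone (nondecreasing or nonincreasing) on each element of a partition of $\mathcal X$ into at most $k$ nontrivial intervals. If $f\in\mathcal M_k$ and $\mathcal J$ is such a partition for $f$, the $\mathcal J$-variation of $f$ is $$V_{\mathcal J}(\mathbf x,f)=\Big(\sum_{J\in\mathcal J}\sqrt{\frac{n_J V_J(f)}{n}}\Big)^2,\qquad V_J(f)=\sup_J f-\inf_J f,$$ where $n_J$ is the number of indices $i$ with $x_i\in J$, and $0\cdot\infty=0$. **Statement.** For every constant $\kappa>0$ there is a constant $C>0$, depending on $\kappa$ only, such that the following holds in every setting as above. Let $k\ge1$, let $f^\star\in\mathcal M_k$, and let $\mathcal J$ be a partition of $\mathcal X$ into at most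 $k$ nontrivial intervals on each of which $f^\star$ is monotone, such that $V_{\mathcal J}=V_{\mathcal J}(\mathbf x,f^\star)$ is finite. If $p\in[1,2]$ and $\sigma_p<+\infty$, then, with $s=1-\frac1p$, $$B_n(f^\star,\mathcal M_k)\le C\left[\sigma_p^{\frac1{s+1}}\Big(\frac{V_{\mathcal J}}n\Big)^{\frac s{s+1}}+\sigma_p\Big(\frac{3k-1}n\Big)^s\right]$$ (with $0^0=1$). -/

import Mathlib

open MeasureTheory ProbabilityTheory
open scoped ENNReal NNReal

universe u

namespace ShapeRegression

/-- The VC-dimension of the class `𝒜` of subsets of `β` is not larger than `D`: for every finite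
`B ⊆ β` with more than `D` elements, some subset of `B` is not of the form `B ∩ A` with `A ∈ 𝒜`. -/
def VCDimLE {β : Type*} (𝒜 : Set (Set β)) (D : ℕ) : Prop :=
  ∀ B : Finset β, D < B.card → ∃ C : Finset β, C ⊆ B ∧ ∀ A ∈ 𝒜, (B : Set β) ∩ A ≠ (C : Set β)

/-- `g₀` is extremal with degree not larger than `D` in the class `G` of functions on `β`. -/
def IsExtremal {β : Type*} (G : Set (β → ℝ)) (g₀ : β → ℝ) (D : ℕ) : Prop :=
  g₀ ∈ G ∧ 1 ≤ D ∧
    VCDimLE {A : Set β | ∃ g ∈ G, A = {y | g₀ y < g y}} D ∧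
    VCDimLE {A : Set β | ∃ g ∈ G, A = {y | g y < g₀ y}} D

/-- The loss `ℓ(f, g) = n⁻¹ ∑ i, |f (x i) - g (x i)|`, as a number in `[0, ∞]`. -/
noncomputable def loss {α : Type*} {n : ℕ} (x : Fin n → α) (f g : α → ℝ) : ℝ≥0∞ :=
  ENNReal.ofReal ((1 / (n : ℝ)) * ∑ i, |f (x i) - g (x i)|)

/-- `ℓ(f, G) = inf_{g ∈ G} ℓ(f, g)`, which is `∞` when `G` is empty. -/
noncomputable def lossTo {α : Type*} {n : ℕ} (x : Fin n → α) (f : α → ℝ) (G : Set (α → ℝ)) :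
    ℝ≥0∞ :=
  ⨅ g ∈ G, loss x f g

/-- The set `𝒪(D)` of those `f ∈ F` whose restriction to the set `{x₁, …, xₙ}` of design points is
extremal, with degree not larger than `D`, in the class of the restrictions of elements of `F`. -/
def extremalSet {α : Type*} {n : ℕ} (x : Fin n → α) (F : Set (α → ℝ)) (D : ℕ) : Set (α → ℝ) :=
  {f | f ∈ F ∧
    IsExtremal ((fun (g : α → ℝ) (y : Set.range x) => g y) '' F) (fun y : Set.range x => f y) D}

/-- The risk bound
`Bₙ(f, F) = inf_{D ≥ 1} { 3 ℓ(f, 𝒪(D)) + κ inf_{p ∈ [1,2]} σ_p (D / n) ^ (1 - 1/p) }`. -/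
noncomputable def riskBound {α : Type*} {n : ℕ} (κ : ℝ≥0) (σ : ℝ → ℝ≥0∞) (x : Fin n → α)
    (f : α → ℝ) (F : Set (α → ℝ)) : ℝ≥0∞ :=
  ⨅ (D : ℕ) (_ : 1 ≤ D), (3 * lossTo x f (extremalSet x F D) +
    κ * ⨅ p ∈ Set.Icc (1 : ℝ) 2, σ p * ENNReal.ofReal (((D : ℝ) / n) ^ (1 - 1 / p)))

/-- `σ_p(x) = (n⁻¹ ∑ i, 𝔼 |Y i - 𝔼 (Y i)| ^ p) ^ (1/p)`, possibly infinite. -/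
noncomputable def noiseLevel {Ω : Type*} [MeasurableSpace Ω] {n : ℕ} (μ : Measure Ω)
    (Y : Fin n → Ω → ℝ) (p : ℝ) : ℝ≥0∞ :=
  ((n : ℝ≥0∞)⁻¹ * ∑ i, ∫⁻ ω, ENNReal.ofReal (|Y i ω - ∫ ω', Y i ω' ∂μ| ^ p) ∂μ) ^ (1 / p)

/-- A nontrivial interval of `ℝ`, that is, an interval with positive length. -/
def IsNontrivialInterval (I : Set ℝ) : Prop := I.OrdConnected ∧ I.Nontrivial

/-- `𝒥` is a partition of `X` into nontrivial intervals. -/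
def IsIntervalPartition (X : Set ℝ) (𝒥 : Finset (Set ℝ)) : Prop :=
  (∀ J ∈ 𝒥, IsNontrivialInterval J) ∧ (𝒥 : Set (Set ℝ)).PairwiseDisjoint id ∧
    ⋃ J ∈ 𝒥, J = X

/-- `𝒥` is a partition of `X` into at most `k` nontrivial intervals, on each of which `f` is
monotone (nondecreasing or nonincreasing). -/
def IsMonotonePartition (X : Set ℝ) (k : ℕ) (f : ℝ → ℝ) (𝒥 : Finset (Set ℝ)) : Prop :=
  IsIntervalPartition X 𝒥 ∧ 𝒥.card ≤ k ∧ ∀ J ∈ 𝒥, MonotoneOn f J ∨ AntitoneOn f J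

/-- The class `ℳ_k` of `k`-piecewise monotone functions on `X`. Functions on `X` are represented
by functions on `ℝ`, whose values outside `X` play no role. -/
def piecewiseMonotone (X : Set ℝ) (k : ℕ) : Set (ℝ → ℝ) :=
  {f | ∃ 𝒥 : Finset (Set ℝ), IsMonotonePartition X k f 𝒥}

/-- `V_J(f) = sup_J f - inf_J f ∈ [0, ∞]`, for `J` nonempty. -/
noncomputable def variationOn (f : ℝ → ℝ) (J : Set ℝ) : ℝ≥0∞ :=
  ((⨆ t ∈ J, (f t : EReal)) - ⨅ t ∈ J, (f t : EReal)).toENNReal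

/-- The number `n_J` of indices `i` such that the design point `x i` falls in `J`. -/
noncomputable def countIn {n : ℕ} (x : Fin n → ℝ) (J : Set ℝ) : ℕ := {i | x i ∈ J}.ncard

/-- The `𝒥`-variation `V_𝒥(x, f) = (∑_{J ∈ 𝒥} √(n_J V_J(f) / n))²`, with values in `[0, ∞]`
and the convention `0 · ∞ = 0`. -/
noncomputable def partitionVariation {n : ℕ} (x : Fin n → ℝ) (f : ℝ → ℝ)
    (𝒥 : Finset (Set ℝ)) : ℝ≥0∞ :=
  (∑ J ∈ 𝒥, ((countIn x J : ℝ≥0∞) * variationOn f J / (n : ℝ≥0∞)) ^ (1 / 2 : ℝ)) ^ 2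

end ShapeRegression

/-! Round `f⋆` on each piece `J` down to `d_J` equally spaced steps. The result `g` is still in
`ℳ_k`, is constant on at most `∑ (d_J + 1)` order-convex sets, and has loss at most `∑ n_J V_J / (n
d_J)`. Such a `g` is extremal of small degree: for `f ∈ ℳ_k`, three design points in one piece of
`f` and one constancy set of `g` see `f - g` monotone, so its sign cannot alternate on them.
Shattering would force alternation along the sorted points, hence a change of piece or of constancy
set within every three consecutive points; convexity allows few changes (`vcDimLE_of_convexFibers`,
`mem_extremalSet_of_colouring`). With `a_J = √(n_J V_J / n)` and `A = ∑ a_J`, so that `V_𝒥 = A²`,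
taking `d_J` about `t a_J / A` gives loss at most `V_𝒥 / t` with `D ≤ 2t + 6k + 2`. The bound
follows by balancing `V_𝒥 / t` against `σ_p (t / n)^s`. -/

namespace ShapeRegression

/-! ### Alternating patterns and VC-dimension -/

open Finset in
-- By convexity a colour once left never returns, so a change at `i` can be charged injectively to
-- the colour `c i`.
theorem card_changes_le {ι : Type*} [DecidableEq ι] (m : ℕ) (c : ℕ → ι) (T : Finset ι)
    (hT : ∀ i < m, c i ∈ T)
    (hc : ∀ i j l, i ≤ j → j ≤ l → l < m → c i = c l → c j = c i) :
    ((range (m - 1)).filter fun i => c i ≠ c (i + 1)).card ≤ T.card := by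
  refine card_le_card_of_injOn c ?_ ?_
  · intro i hi
    simp only [coe_filter, mem_range, Set.mem_ofPred_eq] at hi
    exact hT i (by omega)
  · intro i hi j hj hij
    simp only [coe_filter, mem_range, Set.mem_ofPred_eq] at hi hj
    rcases lt_trichotomy i j with h | h | h
    · exact absurd (hc i (i + 1) j (by omega) (by omega) (by omega) hij).symm hi.2
    · exact h
    · exact absurd (hc j (j + 1) i (by omega) (by omega) (by omega) hij.symm).symm hj.2

open Finset in
/-- If there are few changes of each of two colours along `0, …, m - 1`, and no three consecutive
indices share both colours, then `m` is small. -/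
theorem le_of_no_constant_triple {ι₁ ι₂ : Type*} [DecidableEq ι₁] [DecidableEq ι₂] (m : ℕ)
    (c₁ : ℕ → ι₁) (c₂ : ℕ → ι₂) (T₁ : Finset ι₁) (T₂ : Finset ι₂)
    (hT₁ : ∀ i < m, c₁ i ∈ T₁) (hT₂ : ∀ i < m, c₂ i ∈ T₂)
    (hc₁ : ∀ i j l, i ≤ j → j ≤ l → l < m → c₁ i = c₁ l → c₁ j = c₁ i)
    (hc₂ : ∀ i j l, i ≤ j → j ≤ l → l < m → c₂ i = c₂ l → c₂ j = c₂ i)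
    (h : ∀ i, i + 2 < m → ¬ (c₁ i = c₁ (i + 1) ∧ c₁ i = c₁ (i + 2) ∧
      c₂ i = c₂ (i + 1) ∧ c₂ i = c₂ (i + 2))) :
    m ≤ 2 * (T₁.card + T₂.card) + 2 := by
  set S₁ := (range (m - 1)).filter fun i => c₁ i ≠ c₁ (i + 1) with hS₁
  set S₂ := (range (m - 1)).filter fun i => c₂ i ≠ c₂ (i + 1) with hS₂
  have h₁ : S₁.card ≤ T₁.card := card_changes_le m c₁ T₁ hT₁ hc₁
  have h₂ : S₂.card ≤ T₂.card := card_changes_le m c₂ T₂ hT₂ hc₂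
  -- Each triple `i, i + 1, i + 2` has a change at `i` or at `i + 1`; the second case gives the
  -- shifted copy and the factor 2 in the bound.
  have hsub : range (m - 2) ⊆ (S₁ ∪ S₂) ∪ (S₁ ∪ S₂).image (· - 1) := by
    intro i hi
    rw [mem_range] at hi
    by_contra hcon
    simp only [mem_union, mem_image, not_or, not_exists, not_and] at hcon
    obtain ⟨⟨n1, n2⟩, n3⟩ := hcon
    have n4 : i + 1 ∉ S₁ := fun hh => n3 (i + 1) (Or.inl hh) (by omega)
    have n5 : i + 1 ∉ S₂ := fun hh => n3 (i + 1) (Or.inr hh) (by omega)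
    simp only [hS₁, hS₂, mem_filter, mem_range, not_and, not_not] at n1 n2 n4 n5
    have e1 := n1 (by omega)
    have e2 := n2 (by omega)
    have e4 := n4 (by omega)
    have e5 := n5 (by omega)
    exact h i (by omega) ⟨e1, e1.trans e4, e2, e2.trans e5⟩
  have h3 := card_le_card hsub
  have h4 := card_union_le (S₁ ∪ S₂) ((S₁ ∪ S₂).image (· - 1))
  have h5 := card_union_le S₁ S₂
  have h6 : ((S₁ ∪ S₂).image (· - 1)).card ≤ (S₁ ∪ S₂).card := card_image_le
  rw [card_range] at h3
  omega

/-- The fibres of `c` are order-convex. -/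
def HasConvexFibers {β ι : Type*} [Preorder β] (c : β → ι) : Prop :=
  ∀ a b d, a ≤ b → b ≤ d → c a = c d → c b = c a

theorem vcDimLE_of_convexFibers {β ι₁ ι₂ : Type*} [LinearOrder β] (𝒜 : Set (Set β)) (N₁ N₂ : ℕ)
    (h : ∀ A ∈ 𝒜, ∃ (c₁ : β → ι₁) (c₂ : β → ι₂) (T₁ : Finset ι₁) (T₂ : Finset ι₂),
      T₁.card ≤ N₁ ∧ T₂.card ≤ N₂ ∧ (∀ b, c₁ b ∈ T₁) ∧ (∀ b, c₂ b ∈ T₂) ∧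
      HasConvexFibers c₁ ∧ HasConvexFibers c₂ ∧
      ∀ a b d, a ≤ b → b ≤ d → c₁ a = c₁ b → c₁ a = c₁ d → c₂ a = c₂ b → c₂ a = c₂ d →
        (a ∈ A → d ∈ A → b ∈ A) ∧ (b ∈ A → a ∈ A ∨ d ∈ A)) :
    VCDimLE 𝒜 (2 * (N₁ + N₂) + 2) := by
  classical
  intro B hB
  set m := B.card with hm
  have hm0 : 0 < m := by omega
  let e := B.orderEmbOfFin hm.symm
  -- Capping the index makes the increasing enumeration total; only indices below `m` matter.
  let b : ℕ → β := fun i => e ⟨min i (m - 1), by omega⟩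
  have hbmono : Monotone b := fun i j hij => e.monotone (by simp only [Fin.mk_le_mk]; omega)
  have hbinj : ∀ i j, i < m → j < m → b i = b j → i = j := by
    intro i j hi hj hij
    have := e.injective hij
    simp only [Fin.mk.injEq] at this
    omega
  have hbB : ∀ i, b i ∈ B := fun i => B.orderEmbOfFin_mem hm.symm _
  -- The points of even rank cannot be cut out: membership would alternate, and a triple with
  -- constant colours excludes both in-out-in and out-in-out.
  refine ⟨((Finset.range m).filter Even).image b, ?_, ?_⟩
  · intro y hy
    obtain ⟨i, -, rfl⟩ := Finset.mem_image.1 hy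
    exact hbB i
  intro A hA heq
  have key : ∀ i < m, (b i ∈ A ↔ Even i) := by
    intro i hi
    have h1 : b i ∈ (B : Set β) ∩ A ↔ b i ∈ A := by simp [hbB i]
    rw [← h1, heq]
    simp only [Finset.coe_image, Set.mem_image, Finset.coe_filter, Finset.mem_range,
      Set.mem_ofPred_eq]
    constructor
    · rintro ⟨j, ⟨hj, hje⟩, hji⟩
      rwa [← hbinj j i hj hi hji]
    · exact fun hie => ⟨i, ⟨hi, hie⟩, rfl⟩
  obtain ⟨c₁, c₂, T₁, T₂, hN₁, hN₂, hT₁, hT₂, hc₁, hc₂, htri⟩ := h A hA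
  have := le_of_no_constant_triple m (c₁ ∘ b) (c₂ ∘ b) T₁ T₂ (fun i _ => hT₁ _) (fun i _ => hT₂ _)
    (fun i j l hij hjl _ => hc₁ _ _ _ (hbmono hij) (hbmono hjl))
    (fun i j l hij hjl _ => hc₂ _ _ _ (hbmono hij) (hbmono hjl)) (by
      rintro i hi ⟨e1, e2, e3, e4⟩
      have := htri (b i) (b (i + 1)) (b (i + 2)) (hbmono (by omega)) (hbmono (by omega)) e1 e2 e3 e4
      rw [key i (by omega), key (i + 1) (by omega), key (i + 2) hi] at this
      rcases Nat.even_or_odd i with hev | hodd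
      · have := this.1 hev (by simpa [Nat.even_add] using hev)
        simp [Nat.even_add_one, hev] at this
      · rw [← Nat.not_even_iff_odd] at hodd
        have := this.2 (by simpa [Nat.even_add_one] using hodd)
        simp [Nat.even_add, hodd] at this)
  omega

/-! ### Extremal functions in `ℳ_k` -/

/-- The elements of a partition are the values of a colouring. -/
theorem IsIntervalPartition.exists_piece {X : Set ℝ} {𝒥 : Finset (Set ℝ)}
    (h : IsIntervalPartition X 𝒥) :
    ∃ piece : ℝ → Set ℝ, (∀ t ∈ X, piece t ∈ 𝒥 ∧ t ∈ piece t) ∧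
      ∀ J ∈ 𝒥, ∀ t ∈ J, piece t = J := by
  classical
  have hex : ∀ t : ℝ, ∃ J : Set ℝ, t ∈ X → J ∈ 𝒥 ∧ t ∈ J := by
    intro t
    by_cases ht : t ∈ X
    · rw [← h.2.2] at ht
      simp only [Set.mem_iUnion] at ht
      obtain ⟨J, hJ, htJ⟩ := ht
      exact ⟨J, fun _ => ⟨hJ, htJ⟩⟩
    · exact ⟨∅, fun h => absurd h ht⟩
  choose piece hp using hex
  refine ⟨piece, hp, fun J hJ t ht => ?_⟩
  have htX : t ∈ X := by
    rw [← h.2.2]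
    exact Set.mem_biUnion hJ ht
  obtain ⟨h1, h2⟩ := hp t htX
  by_contra hne
  exact Set.disjoint_left.1 (h.2.1 (Finset.mem_coe.2 h1) (Finset.mem_coe.2 hJ) hne) h2 ht

/-- A function in `ℳ_k` that is constant on the `N` convex fibres of a colouring is extremal. -/
theorem mem_extremalSet_of_colouring {n : ℕ} {x : Fin n → ℝ} {X : Set ℝ} (hx : ∀ i, x i ∈ X)
    {k N : ℕ} {g : ℝ → ℝ} (hg : g ∈ piecewiseMonotone X k) {ι : Type*} (c : ℝ → ι)
    (T : Finset ι) (hTN : T.card ≤ N) (hT : ∀ t ∈ X, c t ∈ T)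
    (hconv : ∀ a ∈ X, ∀ b ∈ X, ∀ d ∈ X, a ≤ b → b ≤ d → c a = c d → c b = c a)
    (hconst : ∀ a ∈ X, ∀ b ∈ X, c a = c b → g a = g b) :
    g ∈ extremalSet x (piecewiseMonotone X k) (2 * (k + N) + 2) := by
  have hX : ∀ y : Set.range x, (y : ℝ) ∈ X := by
    rintro ⟨_, i, rfl⟩
    exact hx i
  -- One colour is the piece of `f`, the other the given colour `c`. Where both are constant, `f` is
  -- monotone and `g` constant.
  have hcol : ∀ f ∈ piecewiseMonotone X k, ∃ (c₁ : Set.range x → Set ℝ) (c₂ : Set.range x → ι)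
      (T₁ : Finset (Set ℝ)) (T₂ : Finset ι),
      T₁.card ≤ k ∧ T₂.card ≤ N ∧ (∀ b, c₁ b ∈ T₁) ∧ (∀ b, c₂ b ∈ T₂) ∧
      HasConvexFibers c₁ ∧ HasConvexFibers c₂ ∧
      ∀ a b d, a ≤ b → b ≤ d → c₁ a = c₁ b → c₁ a = c₁ d → c₂ a = c₂ b → c₂ a = c₂ d →
        g a = g b ∧ g a = g d ∧ ((f a ≤ f b ∧ f b ≤ f d) ∨ (f d ≤ f b ∧ f b ≤ f a)) := by
    rintro f ⟨𝒥, h𝒥, hk, hmono⟩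
    obtain ⟨piece, hp, hpu⟩ := h𝒥.exists_piece
    refine ⟨fun y => piece y, fun y => c y, 𝒥, T, hk, hTN, fun y => (hp _ (hX y)).1,
      fun y => hT _ (hX y), ?_, ?_, ?_⟩
    · intro a b d hab hbd had
      obtain ⟨h1, h2⟩ := hp _ (hX a)
      obtain ⟨h3, h4⟩ := hp _ (hX d)
      simp only at had
      rw [← had] at h4
      exact hpu _ h1 _ ((h𝒥.1 _ h1).1.out h2 h4 ⟨hab, hbd⟩)
    · exact fun a b d hab hbd had => hconv _ (hX a) _ (hX b) _ (hX d) hab hbd had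
    · intro a b d hab hbd e1 e2 e3 e4
      refine ⟨hconst _ (hX a) _ (hX b) e3, hconst _ (hX a) _ (hX d) e4, ?_⟩
      obtain ⟨h1, h2⟩ := hp _ (hX a)
      have h3 := (hp _ (hX b)).2
      have h4 := (hp _ (hX d)).2
      simp only at e1 e2
      rw [← e1] at h3
      rw [← e2] at h4
      rcases hmono _ h1 with hm | hm
      · exact Or.inl ⟨hm h2 h3 hab, hm h3 h4 hbd⟩
      · exact Or.inr ⟨hm h3 h4 hbd, hm h2 h3 hab⟩
  refine ⟨hg, ⟨g, hg, rfl⟩, by omega, ?_, ?_⟩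
  · refine vcDimLE_of_convexFibers (ι₁ := Set ℝ) (ι₂ := ι) _ k N ?_
    rintro A ⟨_, ⟨f, hf, rfl⟩, rfl⟩
    obtain ⟨c₁, c₂, T₁, T₂, h1, h2, h3, h4, h5, h6, h7⟩ := hcol f hf
    refine ⟨c₁, c₂, T₁, T₂, h1, h2, h3, h4, h5, h6, fun a b d hab hbd e1 e2 e3 e4 => ?_⟩
    obtain ⟨g1, g2, hm⟩ := h7 a b d hab hbd e1 e2 e3 e4
    simp only [Set.mem_ofPred_eq, ← g1, ← g2]
    rcases hm with ⟨m1, m2⟩ | ⟨m1, m2⟩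
    · exact ⟨fun u _ => u.trans_le m1, fun u => Or.inr (u.trans_le m2)⟩
    · exact ⟨fun _ u => u.trans_le m1, fun u => Or.inl (u.trans_le m2)⟩
  · refine vcDimLE_of_convexFibers (ι₁ := Set ℝ) (ι₂ := ι) _ k N ?_
    rintro A ⟨_, ⟨f, hf, rfl⟩, rfl⟩
    obtain ⟨c₁, c₂, T₁, T₂, h1, h2, h3, h4, h5, h6, h7⟩ := hcol f hf
    refine ⟨c₁, c₂, T₁, T₂, h1, h2, h3, h4, h5, h6, fun a b d hab hbd e1 e2 e3 e4 => ?_⟩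
    obtain ⟨g1, g2, hm⟩ := h7 a b d hab hbd e1 e2 e3 e4
    simp only [Set.mem_ofPred_eq, ← g1, ← g2]
    rcases hm with ⟨m1, m2⟩ | ⟨m1, m2⟩
    · exact ⟨fun _ u => m2.trans_lt u, fun u => Or.inl (m1.trans_lt u)⟩
    · exact ⟨fun u _ => m2.trans_lt u, fun u => Or.inr (m1.trans_lt u)⟩

/-! ### Rounding to finitely many levels -/

/-- A piece without design points may have infinite variation. The value `v = 0` then puts every
point at level 0, since division by zero gives 0, and the approximant is constant there. -/
theorem exists_range_of_variationOn (f : ℝ → ℝ) (J : Set ℝ) :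
    ∃ m v : ℝ, 0 ≤ v ∧ ENNReal.ofReal v ≤ variationOn f J ∧
      ((∀ t ∈ J, m ≤ f t ∧ f t ≤ m + v) ∨ (v = 0 ∧ variationOn f J = ∞)) := by
  by_cases hV : variationOn f J = ∞
  · exact ⟨0, 0, le_rfl, by simp, Or.inr ⟨rfl, hV⟩⟩
  rcases J.eq_empty_or_nonempty with rfl | ⟨t₀, ht₀⟩
  · exact ⟨0, 0, le_rfl, by simp, Or.inl (by simp)⟩
  set S := ⨆ t ∈ J, (f t : EReal) with hS
  set I := ⨅ t ∈ J, (f t : EReal) with hI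
  have hVd : variationOn f J = (S - I).toENNReal := rfl
  have hle : ∀ t ∈ J, (f t : EReal) ≤ S := fun t ht => le_iSup₂ (f := fun t _ => (f t : EReal)) t ht
  have hge : ∀ t ∈ J, I ≤ (f t : EReal) := fun t ht => iInf₂_le (f := fun t _ => (f t : EReal)) t ht
  have hSb : S ≠ ⊥ := ne_bot_of_le_ne_bot (EReal.coe_ne_bot _) (hle t₀ ht₀)
  have hIt : I ≠ ⊤ := ne_top_of_le_ne_top (EReal.coe_ne_top _) (hge t₀ ht₀)
  rw [hVd, EReal.toENNReal_eq_top_iff] at hV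
  have hSt : S ≠ ⊤ := by
    intro h
    rw [h] at hV
    exact hV (EReal.top_sub hIt)
  have hIb : I ≠ ⊥ := by
    intro h
    rw [h] at hV
    exact hV (EReal.sub_bot hSb)
  lift S to ℝ using ⟨hSt, hSb⟩ with S'
  lift I to ℝ using ⟨hIt, hIb⟩ with I'
  have hIS : I' ≤ S' := by exact_mod_cast (hge t₀ ht₀).trans (hle t₀ ht₀)
  refine ⟨I', S' - I', by linarith, ?_, Or.inl fun t ht => ⟨?_, ?_⟩⟩
  · rw [hVd, ← EReal.coe_sub, EReal.toENNReal_of_ne_top (EReal.coe_ne_top _), EReal.toReal_coe]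
  · exact_mod_cast hge t ht
  · have : f t ≤ S' := by exact_mod_cast hle t ht
    linarith

/-- The level of `y` when `[m, m + v]` is divided into `d` intervals of equal length. -/
noncomputable def level (m v : ℝ) (d : ℕ) (y : ℝ) : ℕ := ⌊(y - m) / v * d⌋₊

theorem level_mono {m v : ℝ} (hv : 0 ≤ v) (d : ℕ) : Monotone (level m v d) := by
  intro y z hyz
  unfold level
  gcongr

theorem level_le {m v y : ℝ} (hv : 0 ≤ v) (d : ℕ) (hy : y ≤ m + v ∨ v = 0) :
    level m v d y ≤ d := by
  refine Nat.floor_le_of_le ?_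
  have h : (y - m) / v ≤ 1 := by
    rcases hv.eq_or_lt with h0 | h0
    · rw [← h0]; simp
    · rw [div_le_one h0]
      rcases hy with hy | hy <;> linarith
  calc (y - m) / v * d ≤ 1 * d := by gcongr
    _ = d := one_mul _

theorem abs_sub_level_le {m v y : ℝ} {d : ℕ} (hd : 1 ≤ d) (h1 : m ≤ y) (h2 : y ≤ m + v) :
    |y - (m + level m v d y * (v / d))| ≤ v / d := by
  have hv : 0 ≤ v := by linarith
  have hd' : (0 : ℝ) < d := by exact_mod_cast hd
  rcases hv.eq_or_lt with h0 | h0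
  · have : y = m := by linarith
    simp [this, ← h0]
  have hnn : 0 ≤ (y - m) / v * d := mul_nonneg (div_nonneg (by linarith) hv) hd'.le
  have hlo := Nat.floor_le hnn
  have hhi := Nat.lt_floor_add_one ((y - m) / v * d)
  have hw : 0 < v / d := by positivity
  have e : y - m = ((y - m) / v * d) * (v / d) := by field_simp
  have h3 : (level m v d y : ℝ) * (v / d) ≤ y - m := by
    conv_rhs => rw [e]
    exact mul_le_mul_of_nonneg_right hlo hw.le
  have h4 : y - m ≤ ((level m v d y : ℝ) + 1) * (v / d) := by
    conv_lhs => rw [e]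
    exact mul_le_mul_of_nonneg_right hhi.le hw.le
  rw [abs_le]
  constructor <;> linarith

theorem exists_mem_extremalSet_loss_le {n : ℕ} (hn : 1 ≤ n) {x : Fin n → ℝ} {X : Set ℝ}
    (hx : ∀ i, x i ∈ X) {k : ℕ} {f : ℝ → ℝ} {𝒥 : Finset (Set ℝ)}
    (h : IsMonotonePartition X k f 𝒥) (d : Set ℝ → ℕ) (hd : ∀ J, 1 ≤ d J) :
    ∃ g ∈ extremalSet x (piecewiseMonotone X k) (2 * (k + ∑ J ∈ 𝒥, (d J + 1)) + 2),
      loss x f g ≤ ∑ J ∈ 𝒥, (countIn x J : ℝ≥0∞) * variationOn f J / n / d J := by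
  classical
  obtain ⟨piece, hp, hpu⟩ := h.1.exists_piece
  choose m v hv hvV hmv using fun J => exists_range_of_variationOn f J
  let L : ℝ → ℕ := fun t => level (m (piece t)) (v (piece t)) (d (piece t)) (f t)
  let g : ℝ → ℝ := fun t => m (piece t) + L t * (v (piece t) / d (piece t))
  have hL : ∀ t ∈ X, L t ≤ d (piece t) := by
    intro t ht
    refine level_le (hv _) _ ?_
    rcases hmv (piece t) with h1 | h1
    · exact Or.inl (h1 t (hp t ht).2).2
    · exact Or.inr h1.1
  have hLmono : ∀ J ∈ 𝒥, MonotoneOn L J ∨ AntitoneOn L J := by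
    intro J hJ
    rcases h.2.2 J hJ with hm | hm
    · refine Or.inl fun a ha b hb hab => ?_
      simp only [L, hpu J hJ a ha, hpu J hJ b hb]
      exact level_mono (hv J) _ (hm ha hb hab)
    · refine Or.inr fun a ha b hb hab => ?_
      simp only [L, hpu J hJ a ha, hpu J hJ b hb]
      exact level_mono (hv J) _ (hm ha hb hab)
  have hmul : ∀ J, ∀ a b : ℕ, a ≤ b → m J + a * (v J / d J) ≤ m J + b * (v J / d J) := by
    intro J a b hab
    have := hv J
    gcongr
  have hg : g ∈ piecewiseMonotone X k := by
    refine ⟨𝒥, h.1, h.2.1, fun J hJ => ?_⟩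
    rcases hLmono J hJ with hm | hm
    · refine Or.inl fun a ha b hb hab => ?_
      simp only [g, hpu J hJ a ha, hpu J hJ b hb]
      exact hmul J _ _ (hm ha hb hab)
    · refine Or.inr fun a ha b hb hab => ?_
      simp only [g, hpu J hJ a ha, hpu J hJ b hb]
      exact hmul J _ _ (hm ha hb hab)
  refine ⟨g, mem_extremalSet_of_colouring hx hg
    -- The level `d J` itself occurs, at the top of the range, hence `d J + 1` colours per piece.
    (fun t => (⟨piece t, L t⟩ : (_ : Set ℝ) × ℕ)) (𝒥.sigma fun J => Finset.range (d J + 1))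
    ?_ ?_ ?_ ?_, ?_⟩
  · simp [Finset.card_sigma]
  · intro t ht
    simp only [Finset.mem_sigma, Finset.mem_range]
    exact ⟨(hp t ht).1, Nat.lt_succ_of_le (hL t ht)⟩
  · intro a ha b hb e he hab hbe hae
    simp only [Sigma.mk.injEq, heq_eq_eq] at hae ⊢
    obtain ⟨h1, h2⟩ := hp a ha
    have h3 := (hp e he).2
    rw [← hae.1] at h3
    have h4 := (h.1.1 _ h1).1.out h2 h3 ⟨hab, hbe⟩
    refine ⟨hpu _ h1 b h4, ?_⟩
    rcases hLmono _ h1 with hm | hm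
    · exact le_antisymm ((hm h4 h3 hbe).trans hae.2.ge) (hm h2 h4 hab)
    · exact le_antisymm (hm h2 h4 hab) (hae.2.le.trans (hm h4 h3 hbe))
  · intro a ha b hb hab
    simp only [Sigma.mk.injEq, heq_eq_eq] at hab
    simp only [g, hab.1, hab.2]
  · have hpt : ∀ i, ENNReal.ofReal |f (x i) - g (x i)| ≤
        variationOn f (piece (x i)) / d (piece (x i)) := by
      intro i
      have hd0 : (0 : ℝ) < d (piece (x i)) := by exact_mod_cast hd _
      rcases hmv (piece (x i)) with h1 | h1
      · obtain ⟨h2, h3⟩ := h1 _ (hp _ (hx i)).2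
        refine (ENNReal.ofReal_le_ofReal (abs_sub_level_le (hd _) h2 h3)).trans ?_
        rw [ENNReal.ofReal_div_of_pos hd0, ENNReal.ofReal_natCast]
        exact ENNReal.div_le_div_right (hvV _) _
      · rw [h1.2, ENNReal.top_div_of_ne_top (ENNReal.natCast_ne_top _)]
        exact le_top
    have hn0 : (0 : ℝ) < n := by exact_mod_cast hn
    calc loss x f g = (n : ℝ≥0∞)⁻¹ * ∑ i, ENNReal.ofReal |f (x i) - g (x i)| := by
          rw [loss, ENNReal.ofReal_mul (by positivity), one_div, ENNReal.ofReal_inv_of_pos hn0,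
            ENNReal.ofReal_natCast, ENNReal.ofReal_sum_of_nonneg fun _ _ => abs_nonneg _]
      _ ≤ (n : ℝ≥0∞)⁻¹ * ∑ i, variationOn f (piece (x i)) / d (piece (x i)) := by
          gcongr with i
          exact hpt i
      _ = (n : ℝ≥0∞)⁻¹ * ∑ J ∈ 𝒥, countIn x J * (variationOn f J / d J) := by
          rw [← Finset.sum_fiberwise_of_maps_to (t := 𝒥) (g := fun i => piece (x i))
            (fun i _ => (hp _ (hx i)).1)]
          congr 1
          refine Finset.sum_congr rfl fun J hJ => ?_
          have hc : countIn x J = (Finset.univ.filter fun i => piece (x i) = J).card := by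
            rw [countIn, ← Set.ncard_coe_finset]
            congr 1
            ext i
            simp only [Set.mem_ofPred_eq, Finset.coe_filter, Finset.mem_univ, true_and]
            exact ⟨hpu J hJ _, fun e => e ▸ (hp _ (hx i)).2⟩
          rw [hc, ← nsmul_eq_mul, ← Finset.sum_const]
          refine Finset.sum_congr rfl fun i hi => ?_
          rw [(Finset.mem_filter.1 hi).2]
      _ = _ := by
          rw [Finset.mul_sum]
          refine Finset.sum_congr rfl fun J _ => ?_
          simp only [div_eq_mul_inv]
          ring

/-! ### Distributing the levels among the pieces -/

/-- The cost `a² / d` of a piece is at most `a A / t`, and these bounds sum to `A² / t`. -/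
theorem sq_le_of_mul_div_le {a A t d : ℝ} (ha : 0 ≤ a) (hA : 0 < A) (ht : 0 < t)
    (h : t * a / A ≤ d) : a ^ 2 ≤ a * (A / t) * d := by
  calc a ^ 2 = a * (A / t) * (t * a / A) := by field_simp
    _ ≤ a * (A / t) * d := by gcongr

/-- Choosing the numbers of levels proportionally to `√(n_J V_J)`. -/
theorem exists_mem_extremalSet_loss_le_div {n : ℕ} (hn : 1 ≤ n) {x : Fin n → ℝ} {X : Set ℝ}
    (hx : ∀ i, x i ∈ X) {k : ℕ} {f : ℝ → ℝ} {𝒥 : Finset (Set ℝ)}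
    (h : IsMonotonePartition X k f 𝒥) (hV : partitionVariation x f 𝒥 ≠ ∞) {t : ℝ} (ht : 0 ≤ t)
    (htV : 0 < t ∨ partitionVariation x f 𝒥 = 0) :
    ∃ D : ℕ, 1 ≤ D ∧ (D : ℝ) ≤ 2 * t + 6 * k + 2 ∧
      lossTo x f (extremalSet x (piecewiseMonotone X k) D) ≤
        ENNReal.ofReal ((partitionVariation x f 𝒥).toReal / t) := by
  set e : Set ℝ → ℝ≥0∞ :=
    fun J => ((countIn x J : ℝ≥0∞) * variationOn f J / n) ^ (1 / 2 : ℝ) with he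
  have hPV : partitionVariation x f 𝒥 = (∑ J ∈ 𝒥, e J) ^ 2 := rfl
  have hsum : ∑ J ∈ 𝒥, e J ≠ ∞ := by
    intro hh
    rw [hPV, hh] at hV
    simp at hV
  have heJ : ∀ J ∈ 𝒥, e J ≠ ∞ := fun J hJ => ENNReal.sum_ne_top.1 hsum J hJ
  set a : Set ℝ → ℝ := fun J => (e J).toReal with ha
  have ha0 : ∀ J, 0 ≤ a J := fun J => ENNReal.toReal_nonneg
  set A : ℝ := ∑ J ∈ 𝒥, a J with hA
  have hA0 : 0 ≤ A := Finset.sum_nonneg fun J _ => ha0 J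
  have hAe : (∑ J ∈ 𝒥, e J).toReal = A := ENNReal.toReal_sum heJ
  have hPVA : (partitionVariation x f 𝒥).toReal = A ^ 2 := by
    rw [hPV, ENNReal.toReal_pow, hAe]
  have hsq : ∀ J ∈ 𝒥, (countIn x J : ℝ≥0∞) * variationOn f J / n = ENNReal.ofReal (a J ^ 2) := by
    intro J hJ
    rw [ENNReal.ofReal_pow (ha0 J), ha, ENNReal.ofReal_toReal (heJ J hJ), he]
    rw [← ENNReal.rpow_natCast, ← ENNReal.rpow_mul]
    norm_num
  -- Adding 1 ensures `d J ≥ 1` and `d J ≥ t a_J / A`. Then `∑ (d J + 1) ≤ t + 2k`, whence `D ≤ 2(k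
  -- + t + 2k) + 2`.
  set d : Set ℝ → ℕ := fun J => ⌊t * a J / A⌋₊ + 1 with hd
  obtain ⟨g, hg, hloss⟩ := exists_mem_extremalSet_loss_le hn hx h d (fun J => by simp [hd])
  refine ⟨_, by omega, ?_, (iInf₂_le g hg).trans (hloss.trans ?_)⟩
  · have hcard : (𝒥.card : ℝ) ≤ k := by exact_mod_cast h.2.1
    have h1 : ∑ J ∈ 𝒥, ((d J : ℝ) + 1) ≤ ∑ J ∈ 𝒥, (t * a J / A + 2) := by
      refine Finset.sum_le_sum fun J _ => ?_
      have := Nat.floor_le (show 0 ≤ t * a J / A from div_nonneg (mul_nonneg ht (ha0 J)) hA0)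
      simp only [hd]
      push_cast
      linarith
    have h2 : ∑ J ∈ 𝒥, (t * a J / A + 2) = t * (A / A) + 2 * 𝒥.card := by
      rw [Finset.sum_add_distrib, ← Finset.sum_div, ← Finset.mul_sum, ← hA, mul_div_assoc]
      simp [mul_comm]
    have h3 : t * (A / A) ≤ t := mul_le_of_le_one_right ht (div_self_le_one A)
    push_cast
    linarith
  · have hterm : ∀ J ∈ 𝒥, (countIn x J : ℝ≥0∞) * variationOn f J / n / d J ≤
        ENNReal.ofReal (a J * (A / t)) := by
      intro J hJ
      have hd0 : (0 : ℝ) < d J := by simp only [hd]; positivity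
      rw [hsq J hJ, ← ENNReal.ofReal_natCast, ← ENNReal.ofReal_div_of_pos hd0]
      refine ENNReal.ofReal_le_ofReal ?_
      -- The case `t = 0` is confined to `a J = 0`, since it forces `A = 0`.
      rcases (ha0 J).eq_or_lt with h0 | h0
      · simp [← h0]
      have hAJ : a J ≤ A := Finset.single_le_sum (fun J _ => ha0 J) hJ
      have hApos : 0 < A := h0.trans_le hAJ
      have htpos : 0 < t := by
        rcases htV with h1 | h1
        · exact h1
        · rw [h1] at hPVA
          simp only [ENNReal.toReal_zero] at hPVA
          nlinarith
      have hfl : t * a J / A ≤ d J := by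
        simp only [hd]
        push_cast
        exact (Nat.lt_floor_add_one _).le
      rw [div_le_iff₀ hd0]
      exact sq_le_of_mul_div_le h0.le hApos htpos hfl
    have hfin : ∑ J ∈ 𝒥, ENNReal.ofReal (a J * (A / t)) = ENNReal.ofReal (A ^ 2 / t) := by
      have h0 : ∀ J ∈ 𝒥, 0 ≤ a J * (A / t) := fun J _ => mul_nonneg (ha0 J) (div_nonneg hA0 ht)
      rw [← ENNReal.ofReal_sum_of_nonneg h0, ← Finset.sum_mul, ← hA, sq, mul_div_assoc]
    rw [hPVA, ← hfin]
    exact Finset.sum_le_sum hterm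

/-! ### Optimising the risk bound -/

theorem rpow_mul_add_le {t w s : ℝ} (ht : 0 ≤ t) (hw : 0 ≤ w) (hs0 : 0 ≤ s) (hs1 : s ≤ 1) :
    (4 * (t + w)) ^ s ≤ 4 * (t ^ s + w ^ s) := by
  rw [Real.mul_rpow (by norm_num) (by positivity)]
  have h1 : (4 : ℝ) ^ s ≤ 4 := by
    simpa using Real.rpow_le_rpow_of_exponent_le (show (1 : ℝ) ≤ 4 by norm_num) hs1
  have h2 := Real.rpow_add_le_add_rpow ht hw hs0 hs1
  gcongr

/-- The risk bound for an approximation by roughly `t` constant pieces. -/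
theorem riskBound_piecewiseMonotone_le {n : ℕ} (hn : 1 ≤ n) {x : Fin n → ℝ} {X : Set ℝ}
    (hx : ∀ i, x i ∈ X) {k : ℕ} (hk : 1 ≤ k) {f : ℝ → ℝ} {𝒥 : Finset (Set ℝ)}
    (h : IsMonotonePartition X k f 𝒥) (hV : partitionVariation x f 𝒥 ≠ ∞) (κ : ℝ≥0)
    {σ : ℝ → ℝ≥0∞} {p s : ℝ} (hp : p ∈ Set.Icc (1 : ℝ) 2) (hs : s = 1 - 1 / p) (hσ : σ p ≠ ∞)
    {t : ℝ} (ht : 0 ≤ t) (htV : 0 < t ∨ partitionVariation x f 𝒥 = 0) :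
    riskBound κ σ x f (piecewiseMonotone X k) ≤
      ENNReal.ofReal (3 * ((partitionVariation x f 𝒥).toReal / t) +
        κ * ((σ p).toReal * (4 * ((t / n) ^ s + ((3 * (k : ℝ) - 1) / n) ^ s)))) := by
  obtain ⟨D, hD1, hD, hloss⟩ := exists_mem_extremalSet_loss_le_div hn hx h hV ht htV
  have hn0 : (0 : ℝ) < n := by exact_mod_cast hn
  have hk1 : (1 : ℝ) ≤ k := by exact_mod_cast hk
  have hp0 : 0 < p := by linarith [hp.1]
  have hs0 : 0 ≤ s := by
    rw [hs, sub_nonneg, div_le_one hp0]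
    exact hp.1
  have hs1 : s ≤ 1 := by
    rw [hs]
    linarith [one_div_pos.2 hp0]
  have hw : 0 ≤ (3 * (k : ℝ) - 1) / n := div_nonneg (by linarith) hn0.le
  have htn : 0 ≤ t / n := by positivity
  have hDs : ((D : ℝ) / n) ^ s ≤ 4 * ((t / n) ^ s + ((3 * (k : ℝ) - 1) / n) ^ s) := by
    refine le_trans ?_ (rpow_mul_add_le htn hw hs0 hs1)
    refine Real.rpow_le_rpow (by positivity) ?_ hs0
    -- Since `k ≥ 1`, `2t + 6k + 2 ≤ 4(t + 3k - 1)`.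
    rw [← add_div, ← mul_div_assoc]
    gcongr
    linarith
  have hts : 0 ≤ (t / n) ^ s := Real.rpow_nonneg htn _
  have hws : 0 ≤ ((3 * (k : ℝ) - 1) / n) ^ s := Real.rpow_nonneg hw _
  have hσ0 : 0 ≤ (σ p).toReal := ENNReal.toReal_nonneg
  have hV0 : 0 ≤ (partitionVariation x f 𝒥).toReal := ENNReal.toReal_nonneg
  rw [ENNReal.ofReal_add (by positivity) (by positivity), ENNReal.ofReal_mul (by norm_num),
    ENNReal.ofReal_mul κ.coe_nonneg, ENNReal.ofReal_mul hσ0, ENNReal.ofReal_toReal hσ,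
    ENNReal.ofReal_coe_nnreal, show ENNReal.ofReal 3 = 3 by simp]
  refine (iInf₂_le D hD1).trans ?_
  refine add_le_add (mul_le_mul_right hloss _) (mul_le_mul_right ?_ _)
  refine (iInf₂_le p hp).trans (mul_le_mul_right (ENNReal.ofReal_le_ofReal ?_) _)
  rw [← hs]
  exact hDs

/-- The two terms `V / t` and `τ (t / n) ^ s` are balanced at `t = V / E`. -/
theorem balance_rpow {V τ n s : ℝ} (hV : 0 ≤ V) (hτ : 0 < τ) (hn : 0 < n) (hs : 0 ≤ s) :
    ∃ t, 0 ≤ t ∧ (0 < t ∨ V = 0) ∧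
      V / t ≤ τ ^ (1 / (s + 1)) * (V / n) ^ (s / (s + 1)) ∧
      τ * (t / n) ^ s ≤ τ ^ (1 / (s + 1)) * (V / n) ^ (s / (s + 1)) := by
  have hs1 : s + 1 ≠ 0 := by positivity
  rcases hV.eq_or_lt with h0 | h0
  · refine ⟨0, le_rfl, Or.inr h0.symm, ?_, ?_⟩
    · rw [div_zero]
      positivity
    · rw [← h0, zero_div]
      rcases hs.eq_or_lt with h1 | h1
      · simp [← h1]
      · rw [Real.zero_rpow h1.ne', mul_zero]
        positivity
  set E := τ ^ (1 / (s + 1)) * (V / n) ^ (s / (s + 1)) with hE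
  have hE0 : 0 < E := by positivity
  -- This is the balance equation `τ (t / n)^s = E` at `t = V / E`.
  have hEs : E ^ (s + 1) = τ * (V / n) ^ s := by
    rw [hE, Real.mul_rpow (by positivity) (by positivity), ← Real.rpow_mul hτ.le,
      ← Real.rpow_mul (by positivity), div_mul_cancel₀ _ hs1, div_mul_cancel₀ _ hs1, Real.rpow_one]
  refine ⟨V / E, by positivity, Or.inl (by positivity), ?_, ?_⟩
  · rw [div_div_cancel₀ h0.ne']
  · rw [div_right_comm, Real.div_rpow (by positivity) hE0.le, ← mul_div_assoc, ← hEs,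
      Real.rpow_add_one hE0.ne', mul_div_cancel_left₀ _ (Real.rpow_pos_of_pos hE0 s).ne']

end ShapeRegression

theorem mainTheorem6 (κ : ℝ≥0) (hκ : 0 < κ) :
    ∃ C : ℝ≥0, 0 < C ∧
      ∀ (X : Set ℝ), ShapeRegression.IsNontrivialInterval X →
      ∀ (n : ℕ), 1 ≤ n →
      ∀ (x : Fin n → ℝ), Monotone x → (∀ i, x i ∈ X) →
      ∀ (k : ℕ), 1 ≤ k →
      ∀ (Ω : Type u) [MeasurableSpace Ω] (μ : Measure Ω) [IsProbabilityMeasure μ]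
        (Y : Fin n → Ω → ℝ) (fstar : ℝ → ℝ),
        iIndepFun Y μ → (∀ i, Integrable (Y i) μ) → (∀ i, ∫ ω, Y i ω ∂μ = fstar (x i)) →
      ∀ (σ : ℝ → ℝ≥0∞),
        (∀ q ∈ Set.Icc (1 : ℝ) 2, ShapeRegression.noiseLevel μ Y q ≤ σ q) →
      ∀ (𝒥 : Finset (Set ℝ)), ShapeRegression.IsMonotonePartition X k fstar 𝒥 →
        ShapeRegression.partitionVariation x fstar 𝒥 ≠ ∞ →
      ∀ (p s : ℝ), p ∈ Set.Icc (1 : ℝ) 2 → s = 1 - 1 / p → σ p ≠ ∞ →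
        ShapeRegression.riskBound κ σ x fstar (ShapeRegression.piecewiseMonotone X k) ≤
          C * (σ p ^ (1 / (s + 1)) *
                (ShapeRegression.partitionVariation x fstar 𝒥 / (n : ℝ≥0∞)) ^ (s / (s + 1)) +
              σ p * ENNReal.ofReal (((3 * (k : ℝ) - 1) / n) ^ s)) := by
  -- The 3 is the factor of the loss; the 4 comes from bounding `(D / n)^s`.
  refine ⟨3 + 4 * κ, by positivity, ?_⟩
  intro X _ n hn x _ hx k hk Ω _ μ _ Y f _ _ _ σ _ 𝒥 h hV p s hp hs hσ
  have hrisk := fun (t : ℝ) (ht : 0 ≤ t) htV =>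
    ShapeRegression.riskBound_piecewiseMonotone_le hn hx hk h hV κ hp hs hσ (t := t) ht htV
  set V := ShapeRegression.partitionVariation x f 𝒥 with hVdef
  have hn0 : (0 : ℝ) < n := by exact_mod_cast hn
  have hk1 : (1 : ℝ) ≤ k := by exact_mod_cast hk
  have hs0 : 0 ≤ s := by
    rw [hs, sub_nonneg, div_le_one (by linarith [hp.1])]
    exact hp.1
  have hV0 : 0 ≤ V.toReal := ENNReal.toReal_nonneg
  -- Without noise there is nothing to balance: the risk bound is 0, by letting `t` grow.
  rcases eq_or_ne (σ p) 0 with hσ0 | hσ0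
  · have hle : ShapeRegression.riskBound κ σ x f (ShapeRegression.piecewiseMonotone X k) ≤ 0 := by
      refine le_of_forall_pos_le_add fun ε hε => ?_
      rcases eq_or_ne ε ∞ with rfl | hεt
      · simp
      have hε0 : 0 < ε.toReal := ENNReal.toReal_pos hε.ne' hεt
      refine (hrisk (3 * (V.toReal + 1) / ε.toReal) (by positivity) (Or.inl (by positivity))).trans ?_
      rw [hσ0, zero_add, ENNReal.toReal_zero, zero_mul, mul_zero, add_zero,
        ENNReal.ofReal_le_iff_le_toReal hεt]
      rw [← mul_div_assoc, div_le_iff₀ (by positivity), mul_div_cancel₀ _ hε0.ne']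
      linarith
    exact hle.trans bot_le
  · have hτ : 0 < (σ p).toReal := ENNReal.toReal_pos hσ0 hσ
    obtain ⟨t, ht, htV, hb1, hb2⟩ := ShapeRegression.balance_rpow hV0 hτ hn0 hs0
    refine (hrisk t ht (htV.imp_right fun h0 =>
      ((ENNReal.toReal_eq_zero_iff _).1 h0).resolve_right hV)).trans ?_
    set E := (σ p).toReal ^ (1 / (s + 1)) * (V.toReal / n) ^ (s / (s + 1)) with hE
    have hE0 : 0 ≤ E := by positivity
    set W := ((3 * (k : ℝ) - 1) / n) ^ s with hW
    have hW0 : 0 ≤ W := Real.rpow_nonneg (div_nonneg (by linarith) hn0.le) _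
    have hEe : σ p ^ (1 / (s + 1)) * (V / n) ^ (s / (s + 1)) = ENNReal.ofReal E := by
      rw [hE, ENNReal.ofReal_mul (by positivity),
        ← ENNReal.ofReal_rpow_of_nonneg hτ.le (by positivity),
        ← ENNReal.ofReal_rpow_of_nonneg (by positivity) (by positivity),
        ENNReal.ofReal_div_of_pos hn0, ENNReal.ofReal_toReal hσ, ENNReal.ofReal_toReal hV,
        ENNReal.ofReal_natCast]
    clear_value E W
    have hR : (((3 + 4 * κ : ℝ≥0) : ℝ≥0∞) * (ENNReal.ofReal E + σ p * ENNReal.ofReal W)) =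
        ENNReal.ofReal ((3 + 4 * κ) * (E + (σ p).toReal * W)) := by
      rw [ENNReal.ofReal_mul (by positivity), ENNReal.ofReal_add hE0 (mul_nonneg hτ.le hW0),
        ENNReal.ofReal_mul hτ.le, ENNReal.ofReal_toReal hσ, ← ENNReal.ofReal_coe_nnreal]
      push_cast
      rfl
    rw [hEe, hR]
    refine ENNReal.ofReal_le_ofReal ?_
    have hκ0 : (0 : ℝ) ≤ κ := κ.coe_nonneg
    have h1 : 0 ≤ (σ p).toReal * W := by positivity
    have h2 := mul_le_mul_of_nonneg_left hb2 hκ0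
    linarith
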